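/- **Definitions.** A *convexly ordered equivalence relation* is a structure $(I,<,E)$ where $<$ is a strict total order of $I$, $E$ is an equivalence relation on $I$, and $x\,E\,z$, $x<y<z$ imply $x\,E\,y$. Let $\mathcal K^{ceq}$ be the class of all of them, with the substructure relation $\subseteq$ as $\leq_{\mathcal K}$. For a cardinal $\mu$, $(I,<,E)$ is *$\mu$-big* if at least $\mu$ many of its equivalence classes have size at least $\mu$. Two $n$-tuples $\mathbf a\in I$, $\mathbf b\in I'$ with $I,I'\in\mathcal K^{ceq}$ *have the same type* if they are related by the equivalence relation generated by: there are $J\in\mathcal K^{ceq}$ and embeddings $g:I\to J$, $f:I'\to J$ with $g(\mathbf a)=f(\mathbf b)$; write $tp(\mathbf a;I)$ for the equivalence class, i.e. the *type* of $\mathbf a$. For a colouring $c:[I]^n\to\kappa$ of the $n$-element subsets of $I$, a substructure $I_0\subseteq I$ is *type-homogeneous for $c$* if there is a function $c^*$ from types of increasing $n$-tuples to $\kappa$ such that $c(\{i_1,\dots,i_n\})=c^*(tp(i_1,\dots,i_n;I))$ for all $i_1<\dots<i_n$ in $I_0$. Write $\lambda\xrightarrow{ceq}(\mu)^n_\kappa$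 if for every $\lambda$-big $I\in\mathcal K^{ceq}$ and every $c:[I]^n\to\kappa$ there is a $\mu$-big substructure $I_0\subseteq I$ that is type-homogeneous for $c$. Finally $\beth_0(\kappa)=\kappa$ and $\beth_{k+1}(\kappa)=2^{\beth_k(\kappa)}$. **Proposition.** 1. For every infinite cardinal $\kappa$ and every $n<\omega$, $$\beth_{n(n+2)-1}(\kappa)^+\xrightarrow{ceq}(\kappa^+)^n_\kappa,$$ where for $n=0$ the index $n(n+2)-1$ is read as $0$. 2. Hence $\mathcal K^{ceq}$ with this notion of bigness is a combinatorial Erdős–Rado class. That is, $\mu$-bigness is a bigness notion (if $\mu_1\le\mu_2$, $M$ is $\mu_2$-big and $M$ embeds in $N\in\mathcal K^{ceq}$, then $N$ is $\mu_1$-big; and every type of a finite tuple is realized in every $\aleph_0$-big $M$), and there is a function $F$ from pairs (cardinal, natural number) to cardinals such that $F(\mu,n)\xrightarrow{ceq}(\mu)^n_\kappa$ for all cardinals $\kappa<\mu$ and all $n<\omega$. -/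

import Mathlib

open Cardinal FirstOrder

universe u v w

namespace StructuralPartition

/-- An abstract class `(𝒦, ≤_𝒦)`: a class of structures in a language `L`, with a
relation `≤_𝒦` contained in the substructure relation, both invariant under isomorphism.
`Strong S` means `S ≤_𝒦 N`, for a substructure `S` of `N`. The relation is a partial order on `𝒦`
(antisymmetry is automatic, since the relation is contained in `⊆`). -/
structure AbstractClass where
  L : FirstOrder.Language.{v, w}
  Mem : (M : Type u) → [L.Structure M] → Prop
  Strong : {N : Type u} → [L.Structure N] → L.Substructure N → Prop
  mem_iso : ∀ {M N : Type u} [L.Structure M] [L.Structure N], (M ≃[L] N) → Mem M → Mem N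
  strong_iso : ∀ {M N : Type u} [L.Structure M] [L.Structure N] (f : M ≃[L] N)
    (S : L.Substructure M), Strong S → Strong (S.map f.toHom)
  mem_left : ∀ {N : Type u} [L.Structure N] {S : L.Substructure N}, Strong S → Mem S
  mem_right : ∀ {N : Type u} [L.Structure N] {S : L.Substructure N}, Strong S → Mem N
  strong_refl : ∀ {N : Type u} [L.Structure N], Mem N → Strong (⊤ : L.Substructure N)
  strong_trans : ∀ {N : Type u} [L.Structure N] (S : L.Substructure N) (T : L.Substructure S),
    Strong T → Strong S → Strong (T.map S.subtype.toHom)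

/-- An ordered abstract class: a distinguished binary relation symbol is a (strict) total order of
every member of the class. -/
structure OrderedAbstractClass extends AbstractClass.{u, v, w} where
  lt : L.Relations 2
  isStrictTotalOrder : ∀ {M : Type u} [L.Structure M], Mem M →
    IsStrictTotalOrder M (fun x y => FirstOrder.Language.Structure.RelMap lt ![x, y])

namespace AbstractClass

variable (K : AbstractClass.{u, v, w})

/-- The members of the class. -/
structure Model where
  carrier : Type u
  [str : K.L.Structure carrier]
  mem : K.Mem carrier

attribute [instance] Model.str

instance : CoeSort K.Model (Type u) := ⟨Model.carrier⟩

variable {K}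

/-- A `𝒦`-embedding `f : I → J`: an isomorphism of `I` with some `f(I) ≤_𝒦 J`. -/
def IsKEmbedding {I J : K.Model} (f : I ↪[K.L] J) : Prop :=
  K.Strong f.toHom.range

/-- A strong substructure of a member of the class, as a member of the class. -/
def Model.ofStrong {I : K.Model} {S : K.L.Substructure I} (h : K.Strong S) : K.Model :=
  ⟨S, K.mem_left h⟩

variable (K)

/-- One link of the chain that defines equality of types: `I₁` and `I₂` are `𝒦`-embedded in a common
`J ∈ 𝒦`, with the tuples `a₁` and `a₂` identified. -/
def TypeStep (n : ℕ) (p q : Σ I : K.Model, Fin n → I) : Prop :=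
  ∃ (J : K.Model) (g : p.1 ↪[K.L] J) (f : q.1 ↪[K.L] J), IsKEmbedding g ∧ IsKEmbedding f ∧
    ∀ k, g (p.2 k) = f (q.2 k)

/-- The space of (Galois) `𝒦`-types of `n`-tuples: tuples in members of `𝒦`, modulo the equivalence
relation generated by `TypeStep`, that is, modulo finite chains of such links. -/
def Types (n : ℕ) : Type _ := Quot (K.TypeStep n)

variable {K}

/-- The `𝒦`-type `tp_𝒦(a; I)`. -/
def tp {n : ℕ} (I : K.Model) (a : Fin n → I) : K.Types n := Quot.mk _ ⟨I, a⟩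

end AbstractClass

/-- A bigness notion for `𝒦`, `g μ I` meaning that `I` is `μ`-big. -/
structure IsBignessNotion (K : AbstractClass.{u, v, w}) (g : Cardinal.{u} → K.Model → Prop) :
    Prop where
  mono : ∀ (μ₁ μ₂ : Cardinal.{u}) (M N : K.Model) (f : M ↪[K.L] N), μ₁ ≤ μ₂ →
    AbstractClass.IsKEmbedding f → g μ₂ M → g μ₁ N
  realizes : ∀ M : K.Model, g ℵ₀ M →
    ∀ (n : ℕ) (p : K.Types n), ∃ a : Fin n → M, AbstractClass.tp M a = p

/-- `[X]^n`, the set of `n`-element subsets of `X`. -/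
abbrev Subsets (X : Type u) (n : ℕ) : Type u := {s : Finset X // s.card = n}

namespace OrderedAbstractClass

variable (K : OrderedAbstractClass.{u, v, w})

variable {K} in
/-- `a₁ < ... < aₙ` in `I`. -/
def Increasing {n : ℕ} {I : K.Model} (a : Fin n → I) : Prop :=
  ∀ i j, i < j → FirstOrder.Language.Structure.RelMap K.lt ![a i, a j]

/-- The types of increasing `n`-tuples. -/
def IncTypes (n : ℕ) : Type _ :=
  {p : K.Types n // ∃ (I : K.Model) (a : Fin n → I), Increasing a ∧ p = AbstractClass.tp I a}

variable {K}

theorem Increasing.injective {n : ℕ} {I : K.Model} {a : Fin n → I} (ha : Increasing a) :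
    Function.Injective a := by
  have := K.isStrictTotalOrder I.mem
  intro i j h
  by_contra hne
  rcases lt_or_gt_of_ne hne with hl | hl
  · have h1 := ha _ _ hl
    rw [h] at h1
    exact this.irrefl _ h1
  · have h1 := ha _ _ hl
    rw [h] at h1
    exact this.irrefl _ h1

/-- The set `{a₁, ..., aₙ}` for `a₁ < ... < aₙ`. -/
def Increasing.toSubset {n : ℕ} {I : K.Model} {a : Fin n → I} (ha : Increasing a) : Subsets I n :=
  ⟨Finset.univ.map ⟨a, ha.injective⟩, by simp⟩

/-- The increasing type of an increasing tuple. -/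
def Increasing.tp {n : ℕ} {I : K.Model} {a : Fin n → I} (ha : Increasing a) : K.IncTypes n :=
  ⟨AbstractClass.tp I a, I, a, ha, rfl⟩

/-- `I₀ ⊆ I` is type-homogeneous for the colouring `c : [I]^n → C`: the colour of an increasing tuple
from `I₀` is a function of its `𝒦`-type. -/
def TypeHomogeneous {n : ℕ} {I : K.Model} {C : Type u} (c : Subsets I n → C)
    (I₀ : K.L.Substructure I) : Prop :=
  ∃ cstar : K.IncTypes n → C, ∀ (a : Fin n → I) (ha : Increasing a), (∀ k, a k ∈ I₀) →
    c ha.toSubset = cstar ha.tp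

variable (K)

/-- The structural partition relation `(lam) →^𝒦 (μ)^n_κ` with respect to `g`. -/
def Arrow (g : Cardinal.{u} → K.Model → Prop) (lam μ : Cardinal.{u}) (n : ℕ) (κ : Cardinal.{u}) :
    Prop :=
  ∀ I : K.Model, g lam I → ∀ C : Type u, #C = κ → ∀ c : Subsets I n → C,
    ∃ (I₀ : K.L.Substructure I) (h : K.Strong I₀),
      g μ (AbstractClass.Model.ofStrong h) ∧ TypeHomogeneous c I₀

/-- `𝒦` with the bigness notion `g` is a combinatorial Erdős–Rado class. -/
def IsCombinatorialErdosRado (g : Cardinal.{u} → K.Model → Prop) : Prop :=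
  IsBignessNotion K.toAbstractClass g ∧
    ∃ F : Cardinal.{u} → ℕ → Cardinal.{u}, ∀ κ μ : Cardinal.{u}, κ < μ → ∀ n : ℕ,
      K.Arrow g (F μ n) μ n κ

end OrderedAbstractClass

/-- `ℶ_k(κ)` for finite `k`. -/
noncomputable def bethFrom (κ : Cardinal.{u}) : ℕ → Cardinal.{u}
  | 0 => κ
  | k + 1 => 2 ^ bethFrom κ k

/-- The relation symbols `<` and `E`. -/
inductive CeqRel : ℕ → Type
  | lt : CeqRel 2
  | eqv : CeqRel 2

/-- The language of convexly ordered equivalence relations. -/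
def ceqLang : FirstOrder.Language.{0, 0} := ⟨fun _ => Empty, CeqRel⟩

/-- The symbol `<`. -/
def ltSymb : ceqLang.Relations 2 := CeqRel.lt

/-- The symbol `E`. -/
def eqvSymb : ceqLang.Relations 2 := CeqRel.eqv

section

variable (M : Type u) [ceqLang.Structure M]

/-- `x < y` in `M`. -/
def ceqLt (x y : M) : Prop := FirstOrder.Language.Structure.RelMap ltSymb ![x, y]

/-- `x E y` in `M`. -/
def ceqEqv (x y : M) : Prop := FirstOrder.Language.Structure.RelMap eqvSymb ![x, y]

/-- `(M, <, E)` is a convexly ordered equivalence relation. -/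
structure IsCeq : Prop where
  order : IsStrictTotalOrder M (ceqLt M)
  equiv : Equivalence (ceqEqv M)
  convex : ∀ x y z : M, ceqEqv M x z → ceqLt M x y → ceqLt M y z → ceqEqv M x y

end

theorem ceqLt_map {M N : Type u} [ceqLang.Structure M] [ceqLang.Structure N] (f : M ↪[ceqLang] N)
    (x y : M) : ceqLt N (f x) (f y) ↔ ceqLt M x y := by
  unfold ceqLt
  rw [← f.map_rel]
  congr! 1
  ext i
  fin_cases i <;> rfl

theorem ceqEqv_map {M N : Type u} [ceqLang.Structure M] [ceqLang.Structure N]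
    (f : M ↪[ceqLang] N) (x y : M) : ceqEqv N (f x) (f y) ↔ ceqEqv M x y := by
  unfold ceqEqv
  rw [← f.map_rel]
  congr! 1
  ext i
  fin_cases i <;> rfl

theorem IsCeq.of_embedding {M N : Type u} [ceqLang.Structure M] [ceqLang.Structure N]
    (f : M ↪[ceqLang] N) (h : IsCeq N) : IsCeq M where
  order :=
    have := h.order
    { trichotomous := fun x y h1 h2 => f.injective <| this.trichotomous _ _
        (fun h => h1 ((ceqLt_map f _ _).1 h)) (fun h => h2 ((ceqLt_map f _ _).1 h))
      irrefl := fun x hx => this.irrefl _ ((ceqLt_map f _ _).2 hx)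
      trans := fun x y z h1 h2 => (ceqLt_map f _ _).1 <|
        this.trans _ _ _ ((ceqLt_map f _ _).2 h1) ((ceqLt_map f _ _).2 h2) }
  equiv :=
    { refl := fun x => (ceqEqv_map f _ _).1 (h.equiv.refl _)
      symm := fun h1 => (ceqEqv_map f _ _).1 (h.equiv.symm ((ceqEqv_map f _ _).2 h1))
      trans := fun h1 h2 => (ceqEqv_map f _ _).1
        (h.equiv.trans ((ceqEqv_map f _ _).2 h1) ((ceqEqv_map f _ _).2 h2)) }
  convex := fun x y z h1 h2 h3 => (ceqEqv_map f _ _).1 <| h.convex _ _ _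
    ((ceqEqv_map f _ _).2 h1) ((ceqLt_map f _ _).2 h2) ((ceqLt_map f _ _).2 h3)

/-- The class `𝒦^ceq` of convexly ordered equivalence relations, with substructure. -/
def ceqClass : OrderedAbstractClass.{u, 0, 0} where
  L := ceqLang
  Mem M _ := IsCeq M
  Strong {N} _ S := IsCeq S ∧ IsCeq N
  mem_iso f h := h.of_embedding f.symm.toEmbedding
  strong_iso f S h :=
    have hN := h.2.of_embedding f.symm.toEmbedding
    ⟨hN.of_embedding (S.map f.toHom).subtype, hN⟩
  mem_left h := h.1
  mem_right h := h.2
  strong_refl h := ⟨h.of_embedding (FirstOrder.Language.Substructure.subtype ⊤), h⟩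
  strong_trans S T _ h := ⟨h.2.of_embedding (T.map S.subtype.toHom).subtype, h.2⟩
  lt := ltSymb
  isStrictTotalOrder h := h.order

/-- The equivalence classes of a structure of `𝒦^ceq`. -/
def ceqClasses (M : Type u) [ceqLang.Structure M] : Set (Set M) :=
  {A | ∃ x : M, A = {y | ceqEqv M x y}}

instance (I : ceqClass.{u}.Model) : ceqLang.Structure I := I.str

/-- `μ`-bigness in `𝒦^ceq`: at least `μ` equivalence classes have size at least `μ`. -/
def ceqBig (μ : Cardinal.{u}) (I : ceqClass.{u}.Model) : Prop :=
  μ ≤ #{A : Set I // A ∈ ceqClasses I ∧ μ ≤ #A}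

end StructuralPartition

namespace StructuralPartition

open Set Order

/-! By `ceqEqv_iff_of_tp_eq` the type of a tuple determines which of its entries are equivalent, so
it suffices to find a big set on which the colour of an increasing tuple depends only on that
pattern (`exists_typeHomogeneous`).

For `2 ≤ n` (`exists_homogeneous_of_two_le`), a point is coordinatized by a representative of its
class and a position in a long monotone sequence inside that class. The colour becomes a function of
two tuples, one of classes and one of positions. A polarized Erdős–Rado theorem
(`erdosRado_polarized`) gives large sets `H` of classes and `T` of positions on which the colour
depends only on the two order patterns. From these, `κ⁺` classes are taken in monotone order, and
each receives its own block of `κ⁺` positions, the blocks being ordered like the classes. Comparing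
positions in different blocks then amounts to comparing classes. Since classes are convex, the
equivalence pattern of an increasing tuple determines both order patterns, hence the colour.

The polarized theorem applies ordinary Erdős–Rado twice. The colour of a tuple of classes is first a
whole function of the position tuples, which is affordable when the set of positions is small
compared with `H`; the resulting colouring of position tuples is then made homogeneous. The case `n
= 1` is a double pigeonhole, and `n = 0` is trivial.

Every type is realized in an `ℵ₀`-big structure because a finite tuple is described by its order and
equivalence patterns (`ceq_tp_eq`), and finite orders embed in infinite ones, both among the classes
and inside each class. -/

/-! ### Iterated powers and the Erdős–Rado theorem for finite sets. -/

theorem aleph0_le_bethFrom {κ : Cardinal.{u}} (h : ℵ₀ ≤ κ) (k : ℕ) : ℵ₀ ≤ bethFrom κ k := by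
  induction k with
  | zero => exact h
  | succ k ih => exact ih.trans (cantor _).le

theorem bethFrom_add (κ : Cardinal.{u}) (m k : ℕ) :
    bethFrom (bethFrom κ m) k = bethFrom κ (m + k) := by
  induction k with
  | zero => rfl
  | succ k ih => rw [← add_assoc, bethFrom, bethFrom, ih]

theorem bethFrom_mono_right (κ : Cardinal.{u}) : Monotone (bethFrom κ) :=
  monotone_nat_of_le_succ fun _ => (cantor _).le

/-- This is why `2 ^ θ` colours are allowed throughout: a colour may itself be a function on a set
of size at most `θ`, so several colourings can be bundled into one. -/
theorem mk_arrow_le_two_power {P : Type v} {C : Type u} {θ : Cardinal.{max u v}} (hθ : ℵ₀ ≤ θ)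
    (hP : Cardinal.lift.{u} #P ≤ θ) (hC : Cardinal.lift.{v} #C ≤ 2 ^ θ) : #(P → C) ≤ 2 ^ θ := by
  rw [mk_arrow]
  calc Cardinal.lift.{v} #C ^ Cardinal.lift.{u} #P
      ≤ (2 ^ θ) ^ Cardinal.lift.{u} #P := power_le_power_right hC
    _ ≤ (2 ^ θ) ^ θ := power_le_power_left (power_ne_zero _ two_ne_zero) hP
    _ = 2 ^ θ := by rw [← power_mul, mul_eq_self hθ]

/-- If `X` has more than `2 ^ λ` elements, then it has a subset of size at most `2 ^ λ` that realizes,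
over each of its subsets of size at most `λ`, every colour pattern. -/
theorem exists_pattern_closed_set {lam : Cardinal.{u}} (hlam : ℵ₀ ≤ lam) {X C : Type u}
    (hX : 2 ^ lam < #X) (hC : #C ≤ 2 ^ lam) (c : Finset X → C) :
    ∃ (A : Set X) (x : X), x ∉ A ∧ ∀ B ⊆ A, #B ≤ lam →
      ∃ y ∈ A, y ∉ B ∧ ∀ s : Finset X, (s : Set X) ⊆ B →
        ∀ _ : DecidableEq X, c (insert y s) = c (insert x s) := by
  classical
  obtain ⟨Lam, rfl⟩ : ∃ Lam : Type u, #Lam = lam := ⟨lam.out, mk_out _⟩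
  have : Infinite Lam := infinite_iff.2 hlam
  have hX0 : Nonempty X := mk_ne_zero_iff.1 (zero_le.trans_lt hX).ne'
  let x₀ : X := Classical.arbitrary X
  let P (q : Finset Lam → C) (b : Lam → X) (y : X) : Prop :=
    y ∉ range b ∧ ∀ s : Finset Lam, c (insert y (s.image b)) = q s
  -- A signature with one constant and, for each colour pattern `q`, an operation of arity `Lam`
  -- choosing a realization of `q`. The set `A` generated by it has at most `2 ^ λ` elements, since
  -- there are at most `2 ^ λ` operations, each of arity `λ`.
  let α : Type u := PUnit.{u + 1} ⊕ (Finset Lam → C)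
  let β : α → Type u := Sum.elim (fun _ => PEmpty) (fun _ => Lam)
  let g : (Σ a : α, β a → X) → X
    | ⟨Sum.inl _, _⟩ => x₀
    | ⟨Sum.inr q, b⟩ => if h : ∃ y, P q b y then h.choose else x₀
  let A : Set X := range (WType.elim (β := β) X g)
  have h2 : ℵ₀ ≤ (2 : Cardinal.{u}) ^ #Lam := hlam.trans (cantor _).le
  have hα : #α ≤ 2 ^ #Lam := by
    have : #(Finset Lam → C) ≤ 2 ^ #Lam :=
      mk_arrow_le_two_power hlam (by simp [mk_finset_of_infinite]) (by simpa using hC)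
    simp only [α, mk_sum, lift_id, mk_punit]
    exact add_le_of_le h2 (one_le_aleph0.trans h2) this
  have hA : #A ≤ 2 ^ #Lam := by
    refine mk_range_le.trans (WType.cardinalMk_le_of_le ?_)
    calc Cardinal.sum (fun a : α => ((2 : Cardinal.{u}) ^ #Lam) ^ #(β a))
        ≤ Cardinal.sum (fun _ : α => (2 : Cardinal.{u}) ^ #Lam) := by
          refine sum_le_sum _ _ fun a => ?_
          rcases a with a | a
          · simpa [β] using one_le_aleph0.trans h2
          · simp only [β, Sum.elim_inr]
            rw [← power_mul, mul_eq_self hlam]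
      _ = #α * 2 ^ #Lam := by simp
      _ ≤ 2 ^ #Lam * 2 ^ #Lam := mul_le_mul_left hα _
      _ = 2 ^ #Lam := mul_eq_self h2
  have hAne : (A : Set X).Nonempty := ⟨_, mem_range_self (WType.mk (Sum.inl PUnit.unit) PEmpty.elim)⟩
  obtain ⟨x, hx⟩ : ∃ x, x ∉ A := by
    by_contra! h
    have : A = Set.univ := eq_univ_of_forall h
    rw [this, mk_univ] at hA
    exact hX.not_ge hA
  refine ⟨A, x, hx, fun B hBA hB => ?_⟩
  obtain ⟨b, hbA, hbB⟩ : ∃ b : Lam → X, range b ⊆ A ∧ B ⊆ range b := by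
    rcases B.eq_empty_or_nonempty with rfl | hne
    · obtain ⟨y, hy⟩ := hAne
      exact ⟨fun _ => y, by rintro _ ⟨_, rfl⟩; exact hy, empty_subset _⟩
    · have := hne.to_subtype
      obtain ⟨f⟩ := hB
      let b : Lam → X := fun l => (Function.invFun f l : B)
      refine ⟨b, by rintro _ ⟨l, rfl⟩; exact hBA (Subtype.prop _), fun y hy => ⟨f ⟨y, hy⟩, ?_⟩⟩
      simp only [b, Function.leftInverse_invFun f.injective ⟨y, hy⟩]
  choose w hw using fun l : Lam => hbA (mem_range_self l)
  -- The pattern of `x` over `b` is realized, by `x` itself, so the operation indexed by `q` returns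
  -- a genuine realization, and it lies in `A`.
  let q : Finset Lam → C := fun s => c (insert x (s.image b))
  have hex : ∃ y, P q b y := ⟨x, fun h => hx (hbA h), fun s => rfl⟩
  have hspec := hex.choose_spec
  refine ⟨hex.choose, ⟨WType.mk (Sum.inr q) w, ?_⟩, fun h => hspec.1 (hbB h), fun s hs dec => ?_⟩
  · have hwb : (fun l => WType.elim (β := β) X g (w l)) = b := funext hw
    change g ⟨Sum.inr q, fun l => WType.elim (β := β) X g (w l)⟩ = _
    exact (congrArg (fun f => g ⟨Sum.inr q, f⟩) hwb).trans (dif_pos hex)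
  · obtain ⟨t, rfl⟩ : ∃ t : Finset Lam, t.image b = s := by
      obtain ⟨t, -, ht⟩ := Finset.subset_set_image_iff (s := Set.univ) (f := b) (t := s) |>.1
        (by simpa using hs.trans hbB)
      exact ⟨t, ht⟩
    convert hspec.2 t

/-- An end-homogeneous sequence of length `λ⁺`. -/
theorem exists_endHomogeneous {lam : Cardinal.{u}} (hlam : ℵ₀ ≤ lam) {X C : Type u}
    [DecidableEq X] (hX : 2 ^ lam < #X) (hC : #C ≤ 2 ^ lam) (c : Finset X → C) :
    ∃ (a : (succ lam).ord.ToType → X) (x : X), Function.Injective a ∧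
      ∀ i, ∀ s : Finset (succ lam).ord.ToType, (∀ j ∈ s, j < i) →
        c (insert (a i) (s.image a)) = c (insert x (s.image a)) := by
  obtain ⟨A, x, -, hA⟩ := exists_pattern_closed_set hlam hX hC c
  have hN : ∀ B : Set X, ∃ y, B ⊆ A → #B ≤ lam → y ∈ A ∧ y ∉ B ∧ ∀ s : Finset X, (s : Set X) ⊆ B →
      c (insert y s) = c (insert x s) := by
    intro B
    by_cases h : B ⊆ A ∧ #B ≤ lam
    · obtain ⟨y, h1, h2, h3⟩ := hA B h.1 h.2
      exact ⟨y, fun _ _ => ⟨h1, h2, fun s hs => h3 s hs _⟩⟩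
    · exact ⟨x, fun h1 h2 => absurd ⟨h1, h2⟩ h⟩
  choose N hN using hN
  let ι := (succ lam).ord.ToType
  have wf : WellFounded ((· < ·) : ι → ι → Prop) := wellFounded_lt
  -- Each new term imitates `x` over all earlier terms, of which there are at most `λ`.
  let a : ι → X := wf.fix fun i f => N {y | ∃ j, ∃ h : j < i, y = f j h}
  have ha : ∀ i, a i = N (a '' Iio i) := by
    intro i
    have : a i = N {y | ∃ j, ∃ _ : j < i, y = a j} := wf.fix_eq _ i
    rw [this]
    congr 1
    ext y
    simp [eq_comm]
  have hcard : ∀ i, #(a '' Iio i) ≤ lam := fun i =>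
    mk_image_le.trans (lt_succ_iff.1 (by simpa [ι] using mk_Iio_lt i (by simp [ι])))
  have hmem : ∀ i, a i ∈ A := by
    intro i
    induction i using wf.induction with
    | _ i ih =>
      rw [ha]
      refine (hN _ ?_ (hcard i)).1
      rintro _ ⟨j, hj, rfl⟩
      exact ih j hj
  have hsub : ∀ i, a '' Iio i ⊆ A := by
    rintro i _ ⟨j, -, rfl⟩
    exact hmem j
  have hne : ∀ i j, i < j → a i ≠ a j := by
    intro i j hij h
    have := (hN _ (hsub j) (hcard j)).2.1
    rw [← ha, ← h] at this
    exact this ⟨i, hij, rfl⟩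
  refine ⟨a, x, fun i j h => ?_, fun i s hs => ?_⟩
  · by_contra hij
    rcases lt_or_gt_of_ne hij with hij | hij
    · exact hne _ _ hij h
    · exact hne _ _ hij h.symm
  · have := (hN _ (hsub i) (hcard i)).2.2 (s.image a) (by
      rw [Finset.coe_image]
      exact image_mono fun j hj => hs j hj)
    rwa [← ha] at this

/-- The Erdős–Rado theorem, for all sets of at most `n` elements simultaneously. -/
theorem erdosRado (n : ℕ) {θ : Cardinal.{u}} (hθ : ℵ₀ ≤ θ) {C : Type u} (hC : #C ≤ 2 ^ θ) :
    ∀ {X : Type u}, bethFrom θ n < #X → ∀ c : Finset X → C,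
      ∃ H : Set X, θ < #H ∧ ∀ s t : Finset X, (s : Set X) ⊆ H → (t : Set X) ⊆ H →
        s.card = t.card → s.card ≤ n → c s = c t := by
  classical
  induction n with
  | zero =>
    intro X hX c
    refine ⟨Set.univ, by rw [mk_univ]; exact hX, fun s t _ _ hst hs => ?_⟩
    have hs : s = ∅ := by simpa using hs
    subst hs
    have ht : t = ∅ := by simpa using hst.symm
    rw [ht]
  | succ n ih =>
    intro X hX c
    have hle : θ ≤ bethFrom θ n := bethFrom_mono_right θ (Nat.zero_le n)
    obtain ⟨a, x, hinj, ha⟩ := exists_endHomogeneous (aleph0_le_bethFrom hθ n) hX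
      (hC.trans (power_le_power_left two_ne_zero hle)) c
    -- End-homogeneity lets the largest element of a set be replaced by `x`, so the induction
    -- hypothesis is applied to sets with one element fewer.
    obtain ⟨H, hH, hom⟩ := ih (X := (succ (bethFrom θ n)).ord.ToType)
      (by rw [mk_ord_toType]; exact lt_succ _) fun s => c (insert x (s.image a))
    refine ⟨a '' H, by rwa [mk_image_eq hinj], fun s t hs ht hst hsn => ?_⟩
    rcases s.eq_empty_or_nonempty with rfl | hne
    · have ht : t = ∅ := by simpa using hst.symm
      rw [ht]
    have key : ∀ s : Finset X, (s : Set X) ⊆ a '' H → s.Nonempty →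
        ∃ s' : Finset (succ (bethFrom θ n)).ord.ToType, (s' : Set _) ⊆ H ∧
          s.card = s'.card + 1 ∧ c s = c (insert x (s'.image a)) := by
      intro s hs hne
      obtain ⟨r, hr, rfl⟩ := Finset.subset_set_image_iff.1 hs
      have hrne : r.Nonempty := by simpa using hne
      have hmax := r.max'_mem hrne
      refine ⟨r.erase (r.max' hrne), ?_, ?_, ?_⟩
      · exact fun y hy => hr (Finset.mem_of_mem_erase hy)
      · rw [Finset.card_image_of_injective _ hinj, Finset.card_erase_add_one hmax]
      · rw [← ha (r.max' hrne), ← Finset.image_insert, Finset.insert_erase hmax]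
        exact fun j hj => r.lt_max'_of_mem_erase_max' hrne hj
    obtain ⟨s', hs', hcs, es⟩ := key s hs hne
    obtain ⟨t', ht', hct, et⟩ := key t ht (Finset.card_pos.1 (hst ▸ hne.card_pos))
    rw [es, et]
    exact hom s' t' hs' ht' (by omega) (by omega)

/-! ### Order patterns, monotone sequences and the polarized partition theorem. -/

/-- Two families in linear orders have the same order pattern. -/
def SamePattern {ι : Type w} {X : Type u} {Y : Type v} [LT X] [LT Y] (ξ : ι → X) (η : ι → Y) :
    Prop :=
  ∀ i j, ξ i < ξ j ↔ η i < η j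

theorem SamePattern.eq_iff {ι : Type w} {X : Type u} {Y : Type v} [LinearOrder X] [LinearOrder Y]
    {ξ : ι → X} {η : ι → Y} (h : SamePattern ξ η) (i j : ι) : ξ i = ξ j ↔ η i = η j := by
  rw [eq_iff_le_not_lt, eq_iff_le_not_lt, ← not_lt, ← not_lt, h, h]

/-- Among the indices where the tuples differ, take one with least smaller value, say `ξ i < η i`.
This value is `η j` for some `j`, and the common pattern gives `ξ j < ξ i = η j`, a disagreement
with a smaller value. -/
theorem SamePattern.eq_of_range_eq {n : ℕ} {X : Type u} [LinearOrder X] {ξ η : Fin n → X}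
    (h : SamePattern ξ η) (hr : range ξ = range η) : ξ = η := by
  by_contra hne
  obtain ⟨i₀, hi₀⟩ := Function.ne_iff.1 hne
  obtain ⟨i, hi, hmin⟩ := Finset.exists_min_image (Finset.univ.filter fun i => ξ i ≠ η i)
    (fun i => min (ξ i) (η i)) ⟨i₀, by simpa using hi₀⟩
  simp only [Finset.mem_filter, Finset.mem_univ, true_and] at hi hmin
  rcases lt_or_gt_of_ne hi with hlt | hlt
  · obtain ⟨j, hj⟩ : ξ i ∈ range η := hr ▸ mem_range_self i
    have h1 : ξ j < ξ i := (h j i).2 (hj ▸ hlt)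
    have := hmin j (by rw [hj]; exact h1.ne)
    rw [hj, min_eq_left hlt.le, min_eq_left h1.le] at this
    exact this.not_gt h1
  · obtain ⟨j, hj⟩ : η i ∈ range ξ := hr ▸ mem_range_self i
    have h1 : η j < η i := (h j i).1 (hj ▸ hlt)
    have := hmin j (by rw [hj]; exact h1.ne')
    rw [hj, min_eq_right hlt.le, min_eq_right h1.le] at this
    exact this.not_gt h1

theorem SamePattern.card_image_eq {n : ℕ} {X : Type u} [LinearOrder X] {ξ η : Fin n → X}
    (h : SamePattern ξ η) : (Finset.univ.image ξ).card = (Finset.univ.image η).card := by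
  refine Finset.card_bij (fun x hx => η (Finset.mem_image.1 hx).choose) ?_ ?_ ?_
  · intro x hx
    exact Finset.mem_image_of_mem _ (Finset.mem_univ _)
  · intro x hx y hy hxy
    rw [← (Finset.mem_image.1 hx).choose_spec.2, ← (Finset.mem_image.1 hy).choose_spec.2]
    exact (h.eq_iff _ _).2 hxy
  · intro y hy
    obtain ⟨i, -, rfl⟩ := Finset.mem_image.1 hy
    have hx : ξ i ∈ Finset.univ.image ξ := Finset.mem_image_of_mem _ (Finset.mem_univ _)
    exact ⟨ξ i, hx, (h.eq_iff _ _).1 (Finset.mem_image.1 hx).choose_spec.2⟩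

/-- The Erdős–Rado theorem for tuples with repetitions in a linear order: on a large subset the
colour depends only on the order pattern. -/
theorem erdosRado_pattern (n : ℕ) {θ : Cardinal.{u}} (hθ : ℵ₀ ≤ θ) {C : Type u} (hC : #C ≤ 2 ^ θ)
    {X : Type u} [LinearOrder X] (hX : bethFrom θ n < #X) (Ψ : (Fin n → X) → C) :
    ∃ H : Set X, θ < #H ∧ ∀ ξ η : Fin n → X, (∀ i, ξ i ∈ H) → (∀ i, η i ∈ H) →
      SamePattern ξ η → Ψ ξ = Ψ η := by
  classical
  have hX0 : Nonempty X := mk_ne_zero_iff.1 (zero_le.trans_lt hX).ne'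
  let S (s : Finset X) (R : Fin n → Fin n → Prop) (ξ : Fin n → X) : Prop :=
    Finset.univ.image ξ = s ∧ ∀ i j, ξ i < ξ j ↔ R i j
  let d : C := Ψ fun _ => Classical.arbitrary X
  -- A tuple is recovered from its range and its order pattern, so `Ψ` is encoded as a colouring of
  -- sets whose colours are functions of the pattern.
  let c : Finset X → (Fin n → Fin n → Prop) → C := fun s R =>
    if h : ∃ ξ, S s R ξ then Ψ h.choose else d
  have hc : ∀ ξ : Fin n → X, c (Finset.univ.image ξ) (fun i j => ξ i < ξ j) = Ψ ξ := by
    intro ξ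
    have h : ∃ η, S (Finset.univ.image ξ) (fun i j => ξ i < ξ j) η := ⟨ξ, rfl, fun i j => Iff.rfl⟩
    have he : h.choose = ξ := SamePattern.eq_of_range_eq h.choose_spec.2 <| by
      simpa using congrArg (fun s : Finset X => (s : Set X)) h.choose_spec.1
    exact (dif_pos h).trans (congrArg Ψ he)
  have hfin : Cardinal.lift.{u} #(Fin n → Fin n → Prop) ≤ θ :=
    (lift_le_aleph0.2 (Cardinal.lt_aleph0_of_finite _).le).trans hθ
  obtain ⟨H, hH, hom⟩ := erdosRado n hθ (mk_arrow_le_two_power hθ hfin (by simpa using hC)) hX c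
  refine ⟨H, hH, fun ξ η hξ hη h => ?_⟩
  have hsub : ∀ ξ : Fin n → X, (∀ i, ξ i ∈ H) → ((Finset.univ.image ξ : Finset X) : Set X) ⊆ H := by
    intro ξ hξ
    simpa using range_subset_iff.2 hξ
  have := hom _ _ (hsub ξ hξ) (hsub η hη) h.card_image_eq
    (Finset.card_image_le.trans (by simp))
  rw [← hc ξ, ← hc η, this]
  congr 1
  funext i j
  exact propext (h i j)

theorem exists_strictMono_toType {θ : Cardinal.{u}} {Z : Type u} [LinearOrder Z] [WellFoundedLT Z]
    (h : θ ≤ #Z) : ∃ f : θ.ord.ToType → Z, StrictMono f := by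
  have : Ordinal.type ((· < ·) : θ.ord.ToType → θ.ord.ToType → Prop) ≤
      Ordinal.type ((· < ·) : Z → Z → Prop) := by
    rw [Ordinal.type_toType]
    exact (ord_le_ord.2 h).trans (ord_le_type _)
  obtain ⟨f⟩ := Ordinal.type_le_iff'.1 this
  exact ⟨f, fun _ _ h => f.map_rel_iff.2 h⟩

/-- A large linear order contains a long well-ordered or a long conversely well-ordered sequence. -/
theorem exists_strictMono_or_strictAnti {θ : Cardinal.{u}} (hθ : ℵ₀ ≤ θ) {X : Type u}
    [LinearOrder X] (hX : bethFrom θ 2 < #X) :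
    ∃ f : (succ θ).ord.ToType → X, StrictMono f ∨ StrictAnti f := by
  classical
  let W := (#X).ord.ToType
  obtain ⟨g⟩ : Nonempty (W ≃ X) := Cardinal.eq.1 (mk_ord_toType _)
  -- The Sierpiński colouring: does the order of `X` agree on a pair with a well-order of the same
  -- set?
  let c : Finset W → ULift.{u} Prop := fun s => ⟨∀ x ∈ s, ∀ y ∈ s, g x < g y ↔ x < y⟩
  obtain ⟨H, hH, hom⟩ := erdosRado 2 hθ (X := W) (C := ULift.{u} Prop)
    ((Cardinal.lt_aleph0_of_finite _).le.trans (hθ.trans (cantor _).le))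
    (by rwa [mk_ord_toType]) c
  have hc : ∀ x ∈ H, ∀ y ∈ H, ∀ x' ∈ H, ∀ y' ∈ H, x ≠ y → x' ≠ y' → c {x, y} = c {x', y'} := by
    intro x hx y hy x' hx' y' hy' hne hne'
    refine hom _ _ ?_ ?_ ?_ ?_
    · simp [insert_subset_iff, hx, hy]
    · simp [insert_subset_iff, hx', hy']
    · rw [Finset.card_pair hne, Finset.card_pair hne']
    · rw [Finset.card_pair hne]
  obtain ⟨f, hf⟩ := exists_strictMono_toType (Z := H) (succ_le_of_lt hH)
  have hne : ∀ {i j}, i < j → (f i : W) ≠ f j := fun h => (hf h).ne ∘ Subtype.ext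
  by_cases h0 : ∃ i j, i < j ∧ g (f i) < g (f j)
  · obtain ⟨i₀, j₀, h0, h1⟩ := h0
    refine ⟨fun i => g (f i), Or.inl fun i j hij => ?_⟩
    have hc0 : (c {(f i₀ : W), (f j₀ : W)}).down := by
      simp only [c, Finset.mem_insert, Finset.mem_singleton]
      have h2 : (f i₀ : W) < f j₀ := hf h0
      rintro x (rfl | rfl) y (rfl | rfl)
      · simp
      · exact iff_of_true h1 h2
      · exact iff_of_false h1.asymm h2.asymm
      · simp
    rw [hc _ (f i₀).2 _ (f j₀).2 _ (f i).2 _ (f j).2 (hne h0) (hne hij)] at hc0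
    exact (hc0 (f i) (by simp) (f j) (by simp)).2 (hf hij)
  · push Not at h0
    refine ⟨fun i => g (f i), Or.inr fun i j hij => ?_⟩
    exact lt_of_le_of_ne (h0 i j hij) (g.injective.ne (hne hij).symm)

/-- A polarized Erdős–Rado theorem. -/
theorem erdosRado_polarized (n : ℕ) {θ₁ θ₂ : Cardinal.{u}} (hθ₁ : ℵ₀ ≤ θ₁) (hθ₂ : ℵ₀ ≤ θ₂)
    {X Y C : Type u} [LinearOrder X] [LinearOrder Y] (hX : bethFrom θ₁ n < #X)
    (hY : bethFrom θ₂ n < #Y) (hYθ : #Y ≤ θ₁) (hC₁ : #C ≤ 2 ^ θ₁) (hC₂ : #C ≤ 2 ^ θ₂)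
    (Φ : (Fin n → X) → (Fin n → Y) → C) :
    ∃ (H : Set X) (T : Set Y), θ₁ < #H ∧ θ₂ < #T ∧ ∀ ξ η w w', (∀ i, ξ i ∈ H) → (∀ i, η i ∈ H) →
      (∀ i, w i ∈ T) → (∀ i, w' i ∈ T) → SamePattern ξ η → SamePattern w w' →
      Φ ξ w = Φ η w' := by
  classical
  have hpow : #(Fin n → Y) ≤ θ₁ := by
    rw [mk_arrow]
    refine (power_le_power_right (by simpa using hYθ)).trans ?_
    simpa using power_nat_le hθ₁
  -- The colour of `ξ` is here the entire function `Φ ξ`; there are at most `2 ^ θ₁` of these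
  -- because `Y` has size at most `θ₁`.
  obtain ⟨H, hH, homH⟩ := erdosRado_pattern n hθ₁
    (mk_arrow_le_two_power hθ₁ (by simpa using hpow) (by simpa using hC₁)) hX Φ
  have hX0 : Nonempty X := mk_ne_zero_iff.1 (zero_le.trans_lt hX).ne'
  let S (R : Fin n → Fin n → Prop) (ξ : Fin n → X) : Prop :=
    (∀ i, ξ i ∈ H) ∧ ∀ i j, ξ i < ξ j ↔ R i j
  -- On `H` the function `Φ ξ` depends only on the pattern of `ξ`, so only finitely many functions
  -- of `w` remain to be made homogeneous together.
  let G : (Fin n → Y) → (Fin n → Fin n → Prop) → C := fun w R =>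
    if h : ∃ ξ, S R ξ then Φ h.choose w else Φ (fun _ => Classical.arbitrary X) w
  have hG : ∀ ξ : Fin n → X, (∀ i, ξ i ∈ H) → ∀ w, G w (fun i j => ξ i < ξ j) = Φ ξ w := by
    intro ξ hξ w
    have h : ∃ η, S (fun i j => ξ i < ξ j) η := ⟨ξ, hξ, fun i j => Iff.rfl⟩
    exact (dif_pos h).trans (congrFun (homH _ _ h.choose_spec.1 hξ h.choose_spec.2) w)
  have hfin : Cardinal.lift.{u} #(Fin n → Fin n → Prop) ≤ θ₂ :=
    (lift_le_aleph0.2 (Cardinal.lt_aleph0_of_finite _).le).trans hθ₂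
  obtain ⟨T, hT, homT⟩ := erdosRado_pattern n hθ₂
    (mk_arrow_le_two_power hθ₂ hfin (by simpa using hC₂)) hY G
  refine ⟨H, T, hH, hT, fun ξ η w w' hξ hη hw hw' h h' => ?_⟩
  rw [← hG ξ hξ, ← hG η hη, homT w w' hw hw' h']
  congr 1
  funext i j
  exact propext (h i j)

/-! ### Homogeneous big subsets of a convex equivalence relation. -/

/-- The relation `E` on `S` has at least `μ` pairwise inequivalent elements with class of size at
least `μ` in `S`. -/
def BigOn {I : Type u} (E : I → I → Prop) (μ : Cardinal.{u}) (S : Set I) : Prop :=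
  ∃ R ⊆ S, μ ≤ #R ∧ (∀ r ∈ R, μ ≤ #{y : I // y ∈ S ∧ E r y}) ∧
    ∀ r ∈ R, ∀ r' ∈ R, E r r' → r = r'

/-- Distinct convex classes are comparable as wholes, so inequivalent points compare as any
representatives of their classes do. -/
theorem lt_of_lt_of_convex {I : Type u} [LinearOrder I] {E : I → I → Prop} (hE : Equivalence E)
    (hconv : ∀ x y z, E x z → x < y → y < z → E x y) {x x' y y' : I} (hx : E x x') (hy : E y y')
    (hxy : ¬ E x y) (h : x < y) : x' < y' := by
  by_contra hlt
  have hne : y' ≠ x' := fun h' => hxy (hE.trans hx (h' ▸ hE.symm hy))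
  have hlt : y' < x' := lt_of_le_of_ne (not_lt.1 hlt) hne
  rcases lt_trichotomy y' x with h1 | h1 | h1
  · exact hxy (hE.symm (hE.trans hy (hconv _ _ _ (hE.symm hy) h1 h)))
  · exact hxy (hE.symm (h1 ▸ hy))
  · exact hxy (hE.trans (hconv _ _ _ hx h1 hlt) (hE.symm hy))

theorem lt_iff_lt_of_convex {I : Type u} [LinearOrder I] {E : I → I → Prop} (hE : Equivalence E)
    (hconv : ∀ x y z, E x z → x < y → y < z → E x y) {x x' y y' : I} (hx : E x x') (hy : E y y')
    (hxy : ¬ E x y) : x < y ↔ x' < y' :=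
  ⟨lt_of_lt_of_convex hE hconv hx hy hxy, lt_of_lt_of_convex hE hconv (hE.symm hx) (hE.symm hy)
    fun h => hxy (hE.trans hx (hE.trans h (hE.symm hy)))⟩

theorem exists_homogeneous_of_two_le {I : Type u} [LinearOrder I] {E : I → I → Prop}
    (hE : Equivalence E) (hconv : ∀ x y z, E x z → x < y → y < z → E x y)
    {κ : Cardinal.{u}} (hκ : ℵ₀ ≤ κ) {n : ℕ} (hn : 2 ≤ n)
    (hbig : BigOn E (succ (bethFrom κ (n * (n + 2) - 1))) (Set.univ : Set I)) {C : Type u}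
    (hC : #C ≤ κ) (c : Finset I → C) :
    ∃ S : Set I, BigOn E (succ κ) S ∧ ∀ a b : Fin n → I, StrictMono a → StrictMono b →
      (∀ i, a i ∈ S) → (∀ i, b i ∈ S) → (∀ i j, E (a i) (a j) ↔ E (b i) (b j)) →
      c (Finset.univ.image a) = c (Finset.univ.image b) := by
  classical
  obtain ⟨R, -, hR, hRc, hRE⟩ := hbig
  -- The polarized theorem with `θ₁ = ℶ_{n+2}(κ)` needs more than `ℶ_{2n+2}(κ)` classes. Positions
  -- number `ℶ_{n+1}(κ)⁺`, which is at most `θ₁` and large enough for `θ₂ = ℶ_1(κ)`; monotone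
  -- sequences of that length need classes larger than `ℶ_{n+3}(κ)`. The bound fails for `n = 1`.
  have hindex : 2 * n + 2 ≤ n * (n + 2) - 1 := by
    have : 2 * n ≤ n * n := Nat.mul_le_mul_right n hn
    have h2 : n * (n + 2) = n * n + 2 * n := by ring
    omega
  let Y := (succ (bethFrom κ (n + 1))).ord.ToType
  have hclass : ∀ r : R, ∃ e : Y → {y : I // y ∈ Set.univ ∧ E r y}, StrictMono e ∨ StrictAnti e := by
    intro r
    refine exists_strictMono_or_strictAnti (aleph0_le_bethFrom hκ _) ?_
    rw [bethFrom_add]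
    exact (bethFrom_mono_right κ (by omega)).trans_lt (succ_le_iff.1 (hRc r r.2))
  choose e he using hclass
  have heE : ∀ (r : R) y, E r (e r y : I) := fun r y => (e r y).2.2
  -- The second component records whether each chosen sequence increases, so that homogeneity also
  -- forces a common direction.
  let Φ : (Fin n → R) → (Fin n → Y) → C × (Fin n → Prop) := fun ξ w =>
    (c (Finset.univ.image fun m => (e (ξ m) (w m) : I)), fun m => StrictMono (e (ξ m)))
  have h2κ : ℵ₀ ≤ bethFrom κ 1 := aleph0_le_bethFrom hκ 1
  have hcol : #(C × (Fin n → Prop)) ≤ κ := by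
    rw [mk_prod]
    refine mul_le_of_le hκ (by simpa using hC) ?_
    exact (lift_le_aleph0.2 (Cardinal.lt_aleph0_of_finite _).le).trans hκ
  have hcol' : ∀ k, #(C × (Fin n → Prop)) ≤ 2 ^ bethFrom κ k := fun k =>
    hcol.trans (bethFrom_mono_right κ (Nat.zero_le (k + 1)))
  obtain ⟨H, T, hH, hT, hom⟩ := erdosRado_polarized n (θ₁ := bethFrom κ (n + 2))
    (θ₂ := bethFrom κ 1) (aleph0_le_bethFrom hκ _) h2κ (X := R) (Y := Y)
    (by rw [bethFrom_add]
        exact (bethFrom_mono_right κ (by omega)).trans_lt (succ_le_iff.1 hR))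
    (by rw [bethFrom_add, mk_ord_toType, add_comm]; exact lt_succ _)
    (by rw [mk_ord_toType]; exact succ_le_of_lt (cantor _))
    (hcol' _) (hcol' _) Φ
  obtain ⟨f, hf⟩ := exists_strictMono_or_strictAnti hκ (X := H)
    ((bethFrom_mono_right κ (by omega)).trans_lt hH)
  let K := (succ κ).ord.ToType
  have hK : #K = succ κ := mk_ord_toType _
  have hKK : #(K ×ₗ K) = succ κ := by
    rw [← mul_eq_self (hκ.trans (le_succ κ)), ← hK]
    exact (mk_prod K K).trans (by simp)
  obtain ⟨h, hh⟩ : ∃ h : K ×ₗ K → T, StrictMono h := by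
    have : Ordinal.type ((· < ·) : K ×ₗ K → K ×ₗ K → Prop) ≤
        Ordinal.type ((· < ·) : T → T → Prop) := by
      -- The lexicographic product has `κ⁺ ≤ 2 ^ κ < #T` elements, so its order type lies below the
      -- initial ordinal of `#T`.
      refine le_trans (le_of_lt ?_) (ord_le_type _)
      rw [lt_ord, Ordinal.card_type, hKK]
      exact (succ_le_of_lt (cantor κ)).trans_lt hT
    obtain ⟨f⟩ := Ordinal.type_le_iff'.1 this
    exact ⟨f, fun _ _ h => f.map_rel_iff.2 h⟩
  have hfinj : Function.Injective f := hf.elim StrictMono.injective StrictAnti.injective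
  -- The `i`-th class uses only the `i`-th block of positions.
  let z : K → K → I := fun i k => e (f i) (h (toLex (i, k)))
  have hzE : ∀ i k, E (f i : R) (z i k) := fun i k => heE _ _
  have hzE_iff : ∀ i k i' k', E (z i k) (z i' k') ↔ i = i' := by
    intro i k i' k'
    constructor
    · intro h
      exact hfinj (Subtype.ext (Subtype.ext (hRE _ (f i : R).2 _ (f i' : R).2
        (hE.trans (hzE i k) (hE.trans h (hE.symm (hzE i' k')))))))
    · rintro rfl
      exact hE.trans (hE.symm (hzE i k)) (hzE i k')
  have heinj : ∀ r, Function.Injective (e r) := fun r =>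
    (he r).elim StrictMono.injective StrictAnti.injective
  have hzinj : ∀ i, Function.Injective (z i) := by
    intro i k k' hkk
    have := hh.injective (Subtype.ext (heinj _ (Subtype.ext hkk)))
    exact (Prod.ext_iff.1 (toLex.injective this)).2
  have : Nonempty K := mk_ne_zero_iff.1 (by rw [hK]; exact (succ_ne_bot κ))
  obtain ⟨k₀⟩ := this
  have hz₀inj : Function.Injective fun i => z i k₀ := fun i i' hii =>
    (hzE_iff i k₀ i' k₀).1 (by rw [show z i k₀ = z i' k₀ from hii]; exact hE.refl _)
  refine ⟨range fun p : K × K => z p.1 p.2, ⟨range fun i => z i k₀, ?_, ?_, ?_, ?_⟩, ?_⟩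
  · rintro _ ⟨i, rfl⟩
    exact ⟨(i, k₀), rfl⟩
  · rw [mk_range_eq _ hz₀inj, hK]
  · rintro _ ⟨i, rfl⟩
    rw [← hK]
    exact mk_le_of_injective (f := fun k => ⟨z i k, ⟨(i, k), rfl⟩, (hzE_iff _ _ _ _).2 rfl⟩)
      fun k k' hkk => hzinj i (Subtype.mk.inj hkk)
  · rintro _ ⟨i, rfl⟩ _ ⟨i', rfl⟩ hii
    rw [(hzE_iff _ _ _ _).1 hii]
  · intro a b ha hb haS hbS hab
    choose p hp using haS
    choose q hq using hbS
    obtain rfl : (fun m => z (p m).1 (p m).2) = a := funext hp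
    obtain rfl : (fun m => z (q m).1 (q m).2) = b := funext hq
    have hidx : ∀ m m', (p m).1 = (p m').1 ↔ (q m).1 = (q m').1 := by
      intro m m'
      rw [← hzE_iff _ (p m).2 _ (p m').2, ← hzE_iff _ (q m).2 _ (q m').2]
      exact hab m m'
    -- In an increasing tuple the order of the representatives is determined by the equivalence
    -- pattern, by convexity.
    have hlt : ∀ p : Fin n → K × K, StrictMono (fun m => z (p m).1 (p m).2) → ∀ m m',
        f (p m).1 < f (p m').1 ↔ m < m' ∧ (p m).1 ≠ (p m').1 := by
      intro p hp m m'
      have hnE : ∀ {i i'}, i ≠ i' → ¬ E (f i : R) (f i' : R) := fun hne h =>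
        hne (hfinj (Subtype.ext (Subtype.ext (hRE _ (f _ : R).2 _ (f _ : R).2 h))))
      constructor
      · intro h
        have hne : (p m).1 ≠ (p m').1 := fun h' => by rw [h'] at h; exact lt_irrefl _ h
        exact ⟨hp.lt_iff_lt.1 (lt_of_lt_of_convex hE hconv (hzE _ _) (hzE _ _) (hnE hne) h), hne⟩
      · rintro ⟨h, hne⟩
        refine lt_of_lt_of_convex hE hconv (hE.symm (hzE _ _)) (hE.symm (hzE _ _)) ?_ (hp h)
        rwa [hzE_iff]
    have hξ : SamePattern (fun m => f (p m).1) fun m => f (q m).1 := by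
      intro m m'
      rw [hlt p ha, hlt q hb, Ne, hidx]
    have hidx_lt : ∀ m m', (p m).1 < (p m').1 ↔ (q m).1 < (q m').1 := by
      intro m m'
      rcases hf with hf | hf
      · rw [← hf.lt_iff_lt, ← hf.lt_iff_lt]; exact hξ m m'
      · rw [← hf.lt_iff_gt, ← hf.lt_iff_gt]; exact hξ m' m
    -- Constant tuples of classes all have the same pattern, so their recorded directions agree.
    have hdir : ∀ i i' : K, StrictMono (e (f i)) ↔ StrictMono (e (f i')) := by
      intro i i'
      have := hom (fun _ => f i) (fun _ => f i') (fun _ => h (toLex (i, i)))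
        (fun _ => h (toLex (i, i))) (fun _ => (f i).2) (fun _ => (f i').2) (fun _ => Subtype.prop _)
        (fun _ => Subtype.prop _) (fun _ _ => by simp) (fun _ _ => by simp)
      exact iff_of_eq (congrFun (Prod.ext_iff.1 this).2 ⟨0, by omega⟩)
    -- Within a class, positions follow the index order or its reverse, and the common direction
    -- makes this choice the same for both tuples.
    have hsnd : ∀ m m', (p m).1 = (p m').1 → ((p m).2 < (p m').2 ↔ (q m).2 < (q m').2) := by
      have hlex : ∀ i k k', h (toLex (i, k)) < h (toLex (i, k')) ↔ k < k' := by
        intro i k k'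
        rw [hh.lt_iff_lt, Prod.Lex.toLex_lt_toLex]
        simp
      have hup : ∀ p : Fin n → K × K, StrictMono (fun m => z (p m).1 (p m).2) →
          (∀ i, StrictMono (e (f i))) → ∀ m m', (p m).1 = (p m').1 →
          ((p m).2 < (p m').2 ↔ m < m') := by
        intro p hp he m m' hm
        rw [← hp.lt_iff_lt, ← hlex (p m).1]
        simp only [z, ← hm]
        exact (he (p m).1).lt_iff_lt.symm
      have hdown : ∀ p : Fin n → K × K, StrictMono (fun m => z (p m).1 (p m).2) →
          (∀ i, StrictAnti (e (f i))) → ∀ m m', (p m).1 = (p m').1 →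
          ((p m).2 < (p m').2 ↔ m' < m) := by
        intro p hp he m m' hm
        rw [← hp.lt_iff_lt, ← hlex (p m).1]
        simp only [z, ← hm]
        exact (he (p m).1).lt_iff_gt.symm
      intro m m' hm
      by_cases hs : StrictMono (e (f k₀))
      · have hs' : ∀ i, StrictMono (e (f i)) := fun i => (hdir i k₀).2 hs
        rw [hup p ha hs' m m' hm, hup q hb hs' m m' ((hidx m m').1 hm)]
      · have hs' : ∀ i, StrictAnti (e (f i)) := fun i =>
          (he (f i)).resolve_left fun h => hs ((hdir i k₀).1 h)
        rw [hdown p ha hs' m m' hm, hdown q hb hs' m m' ((hidx m m').1 hm)]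
    have hw : SamePattern (fun m => (h (toLex (p m)) : Y)) fun m => (h (toLex (q m)) : Y) := by
      intro m m'
      change h (toLex (p m)) < h (toLex (p m')) ↔ h (toLex (q m)) < h (toLex (q m'))
      rw [hh.lt_iff_lt, hh.lt_iff_lt, Prod.Lex.lt_iff, Prod.Lex.lt_iff]
      refine or_congr (hidx_lt m m') ⟨fun h => ?_, fun h => ?_⟩
      · exact ⟨(hidx m m').1 h.1, (hsnd m m' h.1).1 h.2⟩
      · exact ⟨(hidx m m').2 h.1, (hsnd m m' ((hidx m m').2 h.1)).2 h.2⟩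
    exact (Prod.ext_iff.1 (hom _ _ _ _ (fun m => (f (p m).1).2) (fun m => (f (q m).1).2)
      (fun m => (h (toLex (p m))).2) (fun m => (h (toLex (q m))).2) hξ hw)).1

/-- Pigeonhole twice, using that `κ⁺` is regular: each large class has `κ⁺` points of one colour,
and `κ⁺` classes share that colour. -/
theorem exists_homogeneous_singleton {I : Type u} {E : I → I → Prop} (hE : Equivalence E)
    {κ : Cardinal.{u}} (hκ : ℵ₀ ≤ κ) (hbig : BigOn E (succ κ) (Set.univ : Set I)) {C : Type u}
    (hC : #C ≤ κ) (c : I → C) :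
    ∃ S : Set I, BigOn E (succ κ) S ∧ ∀ a ∈ S, ∀ b ∈ S, c a = c b := by
  obtain ⟨R, -, hR, hRc, hRE⟩ := hbig
  have hpig : ∀ {β : Type u} (f : β → C), succ κ ≤ #β → ∃ x, succ κ ≤ #(f ⁻¹' {x}) := fun f hβ =>
    infinite_pigeonhole_card f (succ κ) hβ (hκ.trans (le_succ κ))
      (by rw [(isRegular_succ hκ).cof_ord]; exact hC.trans_lt (lt_succ κ))
  choose d hd using fun r : R => hpig (fun y : {y : I // y ∈ Set.univ ∧ E r y} => c y) (hRc r r.2)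
  obtain ⟨x, hx⟩ := hpig d hR
  have hnz : succ κ ≠ 0 := succ_ne_bot κ
  -- The original representative may have another colour, so each class needs a new one of colour
  -- `x`.
  have hrep : ∀ r : d ⁻¹' {x}, ∃ y : I, E (r : R) y ∧ c y = x := by
    rintro ⟨r, hr⟩
    have : Nonempty _ := mk_ne_zero_iff.1 (((pos_iff_ne_zero.2 hnz).trans_le (hd r)).ne')
    obtain ⟨y, hyc⟩ := this
    exact ⟨y, y.2.2, Eq.trans hyc hr⟩
  choose g hgE hgc using hrep
  have hg : ∀ r r', E (g r) (g r') → r = r' := fun r r' h =>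
    Subtype.ext (Subtype.ext (hRE _ (r : R).2 _ (r' : R).2
      (hE.trans (hgE r) (hE.trans h (hE.symm (hgE r'))))))
  refine ⟨{y | c y = x}, ⟨range g, ?_, ?_, ?_, ?_⟩, fun a ha b hb => ha.trans hb.symm⟩
  · rintro _ ⟨r, rfl⟩
    exact hgc r
  · rwa [mk_range_eq _ fun r r' h => hg r r' (by rw [h]; exact hE.refl _)]
  · rintro _ ⟨r, rfl⟩
    refine (hd r).trans (mk_le_of_injective
      (f := fun y => ⟨y.1.1, y.2.trans r.2, hE.trans (hE.symm (hgE r)) y.1.2.2⟩) ?_)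
    intro y y' h
    exact Subtype.ext (Subtype.ext (by simpa using h))
  · rintro _ ⟨r, rfl⟩ _ ⟨r', rfl⟩ h
    rw [hg r r' h]

/-! ### Embeddings, bigness and types in the class of convexly ordered equivalence relations. -/

theorem ceq_isCeq (I : ceqClass.{u}.Model) : IsCeq I := I.mem

/-- The order of a convexly ordered equivalence relation. -/
noncomputable abbrev ceqLinearOrder (I : ceqClass.{u}.Model) : LinearOrder I := by
  classical
  letI := (ceq_isCeq I).order
  exact linearOrderOfSTO (ceqLt I)

theorem IsCeq.substructure {M : Type u} [ceqLang.Structure M] (h : IsCeq M)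
    (S : ceqLang.Substructure M) : IsCeq S :=
  h.of_embedding S.subtype

theorem ceq_isKEmbedding {I J : ceqClass.{u}.Model} (f : I ↪[ceqClass.{u}.L] J) :
    AbstractClass.IsKEmbedding f :=
  ⟨(ceq_isCeq J).substructure f.toHom.range, ceq_isCeq J⟩

/-- Every subset carries a substructure. -/
def ceqSubstructure {M : Type u} [ceqLang.Structure M] (S : Set M) : ceqLang.Substructure M where
  carrier := S
  fun_mem f := Empty.elim f

theorem ceq_strong {I : ceqClass.{u}.Model} (S : ceqClass.{u}.L.Substructure I) :
    ceqClass.{u}.Strong S :=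
  ⟨(ceq_isCeq I).substructure S, ceq_isCeq I⟩

/-- A map that preserves and reflects `<` and `E` is an embedding. -/
def ceqEmbedding {M N : Type u} [ceqLang.Structure M] [ceqLang.Structure N] (f : M → N)
    (hf : Function.Injective f) (hlt : ∀ x y, ceqLt N (f x) (f y) ↔ ceqLt M x y)
    (heqv : ∀ x y, ceqEqv N (f x) (f y) ↔ ceqEqv M x y) : M ↪[ceqLang] N where
  toFun := f
  inj' := hf
  map_fun' g := Empty.elim g
  map_rel' {n} r x := by
    have hx : ∀ x : Fin 2 → M, f ∘ x = ![f (x 0), f (x 1)] ∧ x = ![x 0, x 1] := fun x =>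
      ⟨by ext i; fin_cases i <;> rfl, by ext i; fin_cases i <;> rfl⟩
    cases r with
    | lt =>
      have := hlt (x 0) (x 1)
      unfold ceqLt at this
      rwa [← (hx x).1, ← (hx x).2] at this
    | eqv =>
      have := heqv (x 0) (x 1)
      unfold ceqEqv at this
      rwa [← (hx x).1, ← (hx x).2] at this

theorem bigOn_of_ceqBig {μ : Cardinal.{u}} {I : ceqClass.{u}.Model} (h : ceqBig μ I) :
    BigOn (ceqEqv I) μ Set.univ := by
  have hE := (ceq_isCeq I).equiv
  choose r hr using fun A : {A : Set I // A ∈ ceqClasses I ∧ μ ≤ #A} => A.2.1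
  have hinj : ∀ A B, ceqEqv I (r A) (r B) → A = B := by
    intro A B hAB
    refine Subtype.ext ?_
    rw [hr A, hr B]
    ext y
    exact ⟨fun h => hE.trans (hE.symm hAB) h, fun h => hE.trans hAB h⟩
  refine ⟨range r, subset_univ _, ?_, ?_, ?_⟩
  · rwa [mk_range_eq r fun A B h => hinj A B (by rw [h]; exact hE.refl _)]
  · rintro _ ⟨A, rfl⟩
    refine A.2.2.trans (mk_le_of_injective (f := fun y => ⟨y, Set.mem_univ _, ?_⟩) ?_)
    · exact (Set.ext_iff.1 (hr A) y).1 y.2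
    · exact fun y y' h => Subtype.ext (Subtype.mk.inj h)
  · rintro _ ⟨A, rfl⟩ _ ⟨B, rfl⟩ h
    rw [hinj A B h]

theorem ceqBig_of_bigOn {μ₁ μ₂ : Cardinal.{u}} (hμ : μ₁ ≤ μ₂) {M N : ceqClass.{u}.Model} {S : Set M}
    (h : BigOn (ceqEqv M) μ₂ S) (f : S → N)
    (hf : Function.Injective f)
    (heqv : ∀ x y : S, ceqEqv N (f x) (f y) ↔ ceqEqv M x y) : ceqBig μ₁ N := by
  have hE := (ceq_isCeq N).equiv
  obtain ⟨R, hRS, hR, hRc, hRE⟩ := h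
  refine hμ.trans (hR.trans (mk_le_of_injective
    (f := fun r => ⟨{y | ceqEqv N (f ⟨r, hRS r.2⟩) y}, ⟨_, rfl⟩, ?_⟩) ?_))
  · refine hμ.trans ((hRc r r.2).trans (mk_le_of_injective
      (f := fun y => ⟨f ⟨y, y.2.1⟩, (heqv _ _).2 y.2.2⟩) ?_))
    intro y y' h
    exact Subtype.ext (Subtype.mk.inj (hf (congrArg Subtype.val h)))
  · intro r r' h
    have h1 := congrArg Subtype.val h
    simp only at h1
    have h2 : f ⟨r', hRS r'.2⟩ ∈ {y | ceqEqv N (f ⟨r, hRS r.2⟩) y} := by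
      rw [h1]
      exact hE.refl _
    exact Subtype.ext (hRE _ r.2 _ r'.2 ((heqv _ _).1 h2))

theorem ceqBig_mono {μ₁ μ₂ : Cardinal.{u}} (hμ : μ₁ ≤ μ₂) {M N : ceqClass.{u}.Model}
    (f : M ↪[ceqLang] N) (h : ceqBig μ₂ M) : ceqBig μ₁ N :=
  ceqBig_of_bigOn hμ (bigOn_of_ceqBig h) (fun x => f x)
    (fun _ _ h => Subtype.ext (f.injective h)) (fun _ _ => ceqEqv_map f _ _)

/-- Embeddings preserve and reflect `E`, so each link of the chain defining equality of types keeps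
the equivalence pattern, which therefore descends to the quotient. -/
theorem ceqEqv_iff_of_tp_eq {n : ℕ} {I J : ceqClass.{u}.Model} {a : Fin n → I} {b : Fin n → J}
    (h : AbstractClass.tp I a = AbstractClass.tp J b) (i j : Fin n) :
    ceqEqv I (a i) (a j) ↔ ceqEqv J (b i) (b j) := by
  let F : ceqClass.{u}.Types n → Prop := Quot.lift (fun p => ceqEqv p.1 (p.2 i) (p.2 j)) <| by
    rintro p q ⟨J, g, f, -, -, hgf⟩
    have h1 := ceqEqv_map (M := p.1) (N := J) g (p.2 i) (p.2 j)
    have h2 := ceqEqv_map (M := q.1) (N := J) f (q.2 i) (q.2 j)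
    erw [hgf, hgf] at h1
    exact propext (h1.symm.trans h2)
  exact iff_of_eq (congrArg F h)

/-- Tuples with the same quantifier-free type have the same `𝒦`-type. -/
theorem ceq_tp_eq {n : ℕ} {I J : ceqClass.{u}.Model} {a : Fin n → I} {b : Fin n → J}
    (hlt : ∀ i j, ceqLt I (a i) (a j) ↔ ceqLt J (b i) (b j))
    (heqv : ∀ i j, ceqEqv I (a i) (a j) ↔ ceqEqv J (b i) (b j)) :
    (AbstractClass.tp I a : ceqClass.{u}.Types n) = AbstractClass.tp J b := by
  -- The finite substructure on the tuple embeds in both `I` and `J`, so two links through it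
  -- suffice.
  let S : ceqClass.{u}.L.Substructure I := ceqSubstructure (M := I) (range a)
  let A : ceqClass.{u}.Model := AbstractClass.Model.ofStrong (ceq_strong S)
  let a' : Fin n → A := fun i => (⟨a i, mem_range_self i⟩ : S)
  have hsurj : ∀ x : A, ∃ i, a' i = x := by
    rintro ⟨_, i, rfl⟩
    exact ⟨i, rfl⟩
  let sub : A ↪[ceqLang] I := FirstOrder.Language.Substructure.subtype (L := ceqLang) S
  have hlt' : ∀ i j, ceqLt A (a' i) (a' j) ↔ ceqLt J (b i) (b j) := fun i j =>
    (ceqLt_map sub _ _).symm.trans (hlt i j)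
  have heqv' : ∀ i j, ceqEqv A (a' i) (a' j) ↔ ceqEqv J (b i) (b j) := fun i j =>
    (ceqEqv_map sub _ _).symm.trans (heqv i j)
  have oA := (ceq_isCeq A).order
  have oJ := (ceq_isCeq J).order
  have hinj : ∀ i j, b i = b j ↔ a' i = a' j := by
    intro i j
    constructor
    · intro h
      refine oA.trichotomous _ _ (fun h' => ?_) (fun h' => ?_)
      · rw [hlt', h] at h'; exact oJ.irrefl _ h'
      · rw [hlt', h] at h'; exact oJ.irrefl _ h'
    · intro h
      refine oJ.trichotomous _ _ (fun h' => ?_) (fun h' => ?_)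
      · rw [← hlt', h] at h'; exact oA.irrefl _ h'
      · rw [← hlt', h] at h'; exact oA.irrefl _ h'
  choose ι hι using hsurj
  let g : A ↪[ceqLang] J := ceqEmbedding (fun x => b (ι x))
    (fun x y h => by rw [← hι x, ← hι y]; exact (hinj _ _).1 h)
    (fun x y => by rw [← hlt', hι, hι]) (fun x y => by rw [← heqv', hι, hι])
  have hIA : AbstractClass.TypeStep ceqClass.{u}.toAbstractClass n ⟨A, a'⟩ ⟨I, a⟩ :=
    ⟨I, sub, FirstOrder.Language.Embedding.refl _ _, ceq_isKEmbedding _, ceq_isKEmbedding _,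
      fun k => rfl⟩
  have hJA : AbstractClass.TypeStep ceqClass.{u}.toAbstractClass n ⟨A, a'⟩ ⟨J, b⟩ :=
    ⟨J, g, FirstOrder.Language.Embedding.refl _ _, ceq_isKEmbedding _, ceq_isKEmbedding _,
      fun k => (hinj _ _).2 (hι _)⟩
  exact (Quot.sound hIA).symm.trans (Quot.sound hJA)

theorem ceq_realizes {M : ceqClass.{u}.Model} (hM : ceqBig ℵ₀ M) {n : ℕ} (p : ceqClass.{u}.Types n) :
    ∃ a : Fin n → M, AbstractClass.tp M a = p := by
  obtain ⟨⟨I, a⟩, rfl⟩ := Quot.exists_rep p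
  obtain ⟨R, -, hR, hRc, hRE⟩ := bigOn_of_ceqBig hM
  let _ := ceqLinearOrder M
  let _ := ceqLinearOrder I
  have hEM := (ceq_isCeq M).equiv
  have hEI := (ceq_isCeq I).equiv
  let s : Setoid I := ⟨ceqEqv I, hEI⟩
  let ρ : I → I := fun x => (Quotient.mk s x).out
  have hρ : ∀ x, ceqEqv I (ρ x) x := fun x => Quotient.mk_out (s := s) x
  have hρ_eq : ∀ x y, ρ x = ρ y ↔ ceqEqv I x y := by
    intro x y
    refine ⟨fun h => hEI.trans (hEI.symm (hρ x)) (h ▸ hρ y), fun h => ?_⟩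
    exact congrArg Quotient.out (Quotient.sound (s := s) h)
  have hRinf : Infinite R := infinite_iff.2 hR
  -- The finitely many classes that `a` meets are placed in order among the infinite classes of `M`;
  -- the entries are then placed in order inside each class. Convexity settles comparisons between
  -- classes.
  obtain ⟨φ⟩ := nonempty_orderEmbedding_of_finite_infinite (range fun i => ρ (a i)) R
  have hψ : ∀ r : R, Nonempty (range a ↪o {y : M // y ∈ Set.univ ∧ ceqEqv M r y}) := fun r =>
    have : Infinite {y : M // y ∈ Set.univ ∧ ceqEqv M r y} := infinite_iff.2 (hRc r r.2)
    nonempty_orderEmbedding_of_finite_infinite _ _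
  let ψ := fun r => (hψ r).some
  let r : Fin n → R := fun i => φ ⟨ρ (a i), i, rfl⟩
  let b : Fin n → M := fun i => ψ (r i) ⟨a i, i, rfl⟩
  have hbr : ∀ i, ceqEqv M (r i) (b i) := fun i => (ψ (r i) _).2.2
  have hr_eq : ∀ i j, r i = r j ↔ ceqEqv I (a i) (a j) := by
    intro i j
    rw [← hρ_eq, φ.injective.eq_iff, Subtype.ext_iff]
  have hrE : ∀ i j, ceqEqv M (r i) (r j) ↔ r i = r j := fun i j =>
    ⟨fun h => Subtype.ext (hRE _ (r i).2 _ (r j).2 h), fun h => h ▸ hEM.refl _⟩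
  have heqv : ∀ i j, ceqEqv M (b i) (b j) ↔ ceqEqv I (a i) (a j) := by
    intro i j
    rw [← hr_eq, ← hrE]
    exact ⟨fun h => hEM.trans (hbr i) (hEM.trans h (hEM.symm (hbr j))),
      fun h => hEM.trans (hEM.symm (hbr i)) (hEM.trans h (hbr j))⟩
  have hlt : ∀ i j, b i < b j ↔ a i < a j := by
    intro i j
    by_cases hij : ceqEqv I (a i) (a j)
    · have hψ_lt : ∀ (r r' : R) (_ : r = r') (x y : range a),
          (ψ r x : M) < ψ r' y ↔ (x : I) < y := by
        rintro r _ rfl x y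
        exact (ψ r).lt_iff_lt
      exact hψ_lt _ _ ((hr_eq i j).2 hij) _ _
    · have h1 : ρ (a i) < ρ (a j) ↔ a i < a j :=
        (lt_iff_lt_of_convex hEI (ceq_isCeq I).convex (hEI.symm (hρ _)) (hEI.symm (hρ _)) hij).symm
      rw [← h1, ← lt_iff_lt_of_convex hEM (ceq_isCeq M).convex (hbr i) (hbr j)
        (by rwa [hrE, hr_eq])]
      exact φ.lt_iff_lt
  exact ⟨b, ceq_tp_eq hlt heqv⟩

theorem ceq_isBignessNotion : IsBignessNotion ceqClass.{u}.toAbstractClass ceqBig where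
  mono _ _ _ _ f hμ _ h := ceqBig_mono hμ f h
  realizes _ hM _ p := ceq_realizes hM p

theorem infinite_of_ceqBig {μ : Cardinal.{u}} (hμ : ℵ₀ ≤ μ) {I : ceqClass.{u}.Model}
    (h : ceqBig μ I) : Infinite I := by
  obtain ⟨R, -, hR, -⟩ := bigOn_of_ceqBig h
  exact infinite_iff.2 (hμ.trans (hR.trans (mk_set_le R)))

/-! ### Type-homogeneous substructures and the partition relation. -/

/-- A colouring of the `n`-element subsets that depends, on a `μ`-big subset `S`, only on the
pattern of equivalences has a `μ`-big type-homogeneous substructure. -/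
theorem exists_typeHomogeneous {n : ℕ} {μ : Cardinal.{u}} {I : ceqClass.{u}.Model} {C : Type u}
    [Nonempty C] (c : Subsets I n → C) {S : Set I} (hS : BigOn (ceqEqv I) μ S)
    (h : ∀ (a b : Fin n → I) (ha : OrderedAbstractClass.Increasing (K := ceqClass.{u}) a)
      (hb : OrderedAbstractClass.Increasing (K := ceqClass.{u}) b), (∀ i, a i ∈ S) → (∀ i, b i ∈ S) →
      (∀ i j, ceqEqv I (a i) (a j) ↔ ceqEqv I (b i) (b j)) → c ha.toSubset = c hb.toSubset) :
    ∃ (I₀ : ceqClass.{u}.L.Substructure I) (h : ceqClass.{u}.Strong I₀),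
      ceqBig μ (AbstractClass.Model.ofStrong h) ∧
        OrderedAbstractClass.TypeHomogeneous (K := ceqClass.{u}) c I₀ := by
  classical
  let I₀ : ceqClass.{u}.L.Substructure I := ceqSubstructure (M := I) S
  let sub : (AbstractClass.Model.ofStrong (ceq_strong I₀)) ↪[ceqLang] I :=
    FirstOrder.Language.Substructure.subtype (L := ceqLang) I₀
  refine ⟨I₀, ceq_strong I₀, ?_, ?_⟩
  · refine ceqBig_of_bigOn le_rfl hS (fun x => (x : I₀)) (fun _ _ h => h) fun x y => ?_
    exact (ceqEqv_map sub _ _).symm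
  · let P (p : ceqClass.{u}.IncTypes n) (a : Fin n → I) : Prop :=
      ∃ ha : OrderedAbstractClass.Increasing (K := ceqClass.{u}) a, (∀ i, a i ∈ S) ∧ ha.tp = p
    -- A type gets the colour of a chosen increasing realization in `S`; types not realized there
    -- get an arbitrary colour.
    refine ⟨fun p => if hp : ∃ a, P p a then c hp.choose_spec.choose.toSubset else
      Classical.arbitrary C, fun a ha haS => ?_⟩
    have hp : ∃ b, P ha.tp b := ⟨a, ha, haS, rfl⟩
    have hs := hp.choose_spec.choose_spec
    refine Eq.trans ?_ (dif_pos hp).symm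
    exact h _ _ ha _ haS hs.1 (ceqEqv_iff_of_tp_eq (congrArg Subtype.val hs.2).symm)

theorem ceq_arrow {κ : Cardinal.{u}} (hκ : ℵ₀ ≤ κ) (n : ℕ) {I : ceqClass.{u}.Model}
    (hI : ceqBig (succ (bethFrom κ (n * (n + 2) - 1))) I) {C : Type u} (hC : #C ≤ κ)
    (c : Subsets I n → C) :
    ∃ (I₀ : ceqClass.{u}.L.Substructure I) (h : ceqClass.{u}.Strong I₀),
      ceqBig (succ κ) (AbstractClass.Model.ofStrong h) ∧
        OrderedAbstractClass.TypeHomogeneous (K := ceqClass.{u}) c I₀ := by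
  classical
  have hle : κ ≤ bethFrom κ (n * (n + 2) - 1) := bethFrom_mono_right κ (Nat.zero_le _)
  have hinf : Infinite I := infinite_of_ceqBig ((hκ.trans hle).trans (le_succ _)) hI
  -- An `n`-element subset has a colour, so `C` is nonempty and supplies the default values.
  obtain ⟨s₀, hs₀⟩ := Infinite.exists_subset_card_eq I n
  have hCne : Nonempty C := ⟨c ⟨s₀, hs₀⟩⟩
  have hbig : BigOn (ceqEqv I) (succ κ) Set.univ :=
    bigOn_of_ceqBig (ceqBig_mono (succ_le_succ hle) (FirstOrder.Language.Embedding.refl ceqLang I) hI)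
  let _ := ceqLinearOrder I
  have hE := (ceq_isCeq I).equiv
  let c' : Finset I → C := fun s => if h : s.card = n then c ⟨s, h⟩ else Classical.arbitrary C
  have hc' : ∀ (a : Fin n → I) (ha : OrderedAbstractClass.Increasing (K := ceqClass.{u}) a),
      c' (Finset.univ.image a) = c ha.toSubset := by
    intro a ha
    have h1 : Finset.univ.image a = ha.toSubset.1 := by
      ext x
      simp [OrderedAbstractClass.Increasing.toSubset]
    rw [h1]
    exact dif_pos ha.toSubset.2
  obtain rfl | rfl | hn : n = 0 ∨ n = 1 ∨ 2 ≤ n := by omega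
  · refine exists_typeHomogeneous c hbig fun a b ha hb _ _ _ => ?_
    rw [← hc' a ha, ← hc' b hb, Subsingleton.elim a b]
  · obtain ⟨S, hS, hom⟩ := exists_homogeneous_singleton hE hκ hbig hC fun x => c' {x}
    refine exists_typeHomogeneous c hS fun a b ha hb haS hbS _ => ?_
    rw [← hc' a ha, ← hc' b hb]
    simpa using hom (a 0) (haS 0) (b 0) (hbS 0)
  · obtain ⟨S, hS, hom⟩ := exists_homogeneous_of_two_le hE (ceq_isCeq I).convex hκ hn
      (bigOn_of_ceqBig hI) hC c'
    refine exists_typeHomogeneous c hS fun a b ha hb haS hbS hab => ?_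
    rw [← hc' a ha, ← hc' b hb]
    exact hom a b (fun i j h => ha i j h) (fun i j h => hb i j h) haS hbS hab

end StructuralPartition

theorem mainTheorem10 :
    (∀ (κ : Cardinal.{u}) (n : ℕ), ℵ₀ ≤ κ →
      StructuralPartition.ceqClass.{u}.Arrow StructuralPartition.ceqBig
        (Order.succ (StructuralPartition.bethFrom κ (n * (n + 2) - 1))) (Order.succ κ) n κ) ∧
    StructuralPartition.ceqClass.{u}.IsCombinatorialErdosRado StructuralPartition.ceqBig := by
  refine ⟨fun κ n hκ I hI C hC c => StructuralPartition.ceq_arrow hκ n hI hC.le c,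
    StructuralPartition.ceq_isBignessNotion,
    -- The maximum with `ℵ₀` covers finite `μ`; since `κ < μ`, there are at most `max μ ℵ₀` colours.
    fun μ n => Order.succ (StructuralPartition.bethFrom (max μ ℵ₀) (n * (n + 2) - 1)),
    fun κ μ hκμ n I hI C hC c => ?_⟩
  obtain ⟨I₀, h, hbig, hom⟩ := StructuralPartition.ceq_arrow (le_max_right μ ℵ₀) n hI
    (hC.le.trans (hκμ.le.trans (le_max_left _ _))) c
  exact ⟨I₀, h, StructuralPartition.ceqBig_mono ((le_max_left _ _).trans (Order.le_succ _))
    (FirstOrder.Language.Embedding.refl StructuralPartition.ceqLang _) hbig, hom⟩
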